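/- Let $\kappa$ be an infinite cardinal and $S$ a set with $0<|S|<\kappa$. An $S$-sorted $<\kappa$-ary clone $M$ consists of sets $M_{(\lambda,v,s)}$ ($\lambda<\kappa$ a cardinal, $v:\lambda\to S$, $s\in S$), projections $\pi_{(\lambda,v,i)}\in M_{(\lambda,v,v(i))}$ ($i\in\lambda$) and compositions $c:M_{(\lambda_1,v_1,s)}\times\prod_{i\in\lambda_1}M_{(\lambda_2,v_2,v_1(i))}\to M_{(\lambda_2,v_2,s)}$ subject to $c(f,(c(g_i,h))_i)=c(c(f,g),h)$, $c(\pi_{(\lambda,v,i)},g)=g_i$ and $c(f,(\pi_{(\lambda,v,i)})_i)=f$. For a set $X$ with $|X|<\kappa$ one writes $M_{(X,v,s)}$, using a fixed bijection of $X$ with $|X|$. A clone is single-sorted if its set of sorts is a singleton (its sorts are then just the cardinals $\lambda<\kappa$), and $M$ is pure if for all $s_1,s_2\in S$ there is a unary operation in $M$ from sort $s_1$ to sort $s_2$. An $M$-algebra is a family of sets $A=(A_s)_{s\in S}$ with mappings $\prod_{i\in\lambda}A_{v(i)}\to A_s$ for the $f\in M_{(\lambda,v,s)}$, such that projections act as projections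 and composition acts as composition; $\mathcal V(M)$ is the category of $M$-algebras and homomorphisms. The homogenization $\mathrm H(M)$ is the single-sorted $<\kappa$-ary clone with $\mathrm H_\lambda(M)=\prod_{s\in S}M_{(\lambda\times S,p_2,s)}$, where $p_2(i,t)=t$, with projections $\pi_{(\lambda,i)}=(\pi_{(\lambda\times S,p_2,(i,s))})_{s\in S}$ and composition $c((f_s)_s,((g_{i,t})_t)_{i})=(c(f_s,(g_{i,t})_{(i,t)\in\lambda_1\times S}))_{s}$. The homogenization functor $\mathrm H:\mathcal V(M)\to\mathcal V(\mathrm H(M))$ maps $A$ to $\prod_{s\in S}A_s$, on which $(f_s)_s\in \mathrm H_\lambda(M)$ acts by $((a_{i,t})_t)_i\mapsto(f_s(a_{i,t})_{(i,t)})_s$, and maps a homomorphism $(h_s)_s$ to $(a_s)_s\mapsto(h_s(a_s))_s$. An $S$-sorted pure set is a family $(A_s)_{s\in S}$ of sets that are all empty or all non-empty; with arbitrary families of mappings $(A_s\to B_s)_s$ as morphisms these form the category $\mathbf{Set}^S$. Let $C_{\mathcal D_S}$ be the single-sorted $<\kappa$-ary clone generated by one $S$-ary operation $d$ subject to the diagonal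 identity $d(d(x_{s,t})_{t\in S})_{s\in S}=d(x_{s,s})_{s\in S}$ and the idempotent law $d(x)_{s\in S}=x$, and let $\mathcal D_S=\mathcal V(C_{\mathcal D_S})$ be the category of diagonal algebras of degree $S$. Let $\varphi:\mathbf{Set}^S\to\mathcal D_S$ be the functor that maps $(A_s)_s$ to $\prod_{s}A_s$ with $d((x_{s,t})_t)_s=(x_{s,s})_s$, and $(h_s)_s$ to $(x_s)_s\mapsto(h_s(x_s))_s$. Theorem. Let $M$ be an $S$-sorted pure $<\kappa$-ary clone. Then $\varphi$ is an equivalence of categories, the homogenization functor $\mathrm H:\mathcal V(M)\to\mathcal V(\mathrm H(M))$ is an equivalence of categories, and $$G\circ \mathrm H=\varphi\circ F,$$ where $F:\mathcal V(M)\to\mathbf{Set}^S$ is the forgetful functor that takes the underlying family of sets (which is pure because $M$ is pure), and $G:\mathcal V(\mathrm H(M))\to\mathcal D_S$ is the forgetful functor determined by the clone homomorphism $C_{\mathcal D_S}\to\mathrm H(M)$ with $d\mapsto(\pi_{(S\times S,p_2,(s,s))})_{s\in S}$. So the many-sorted variety $\mathcal V(M)$ is concretely equivalent to the single-sorted variety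 $\mathcal V(\mathrm H(M))$. -/

import Mathlib

open CategoryTheory Cardinal

universe u

namespace ManySorted

/-! ### Arities

An arity is a cardinal `l < κ`; `a.Idx` is a fixed set of cardinality `l` that indexes the
variables.  A set `X` with `#X < κ` is used as an arity through a fixed bijection of `X` with the
index set of the cardinal `#X`. -/

/-- The arities of `<κ`-ary operations: the cardinals below `κ`. -/
abbrev Arity (κ : Cardinal.{u}) : Type (u + 1) := {l : Cardinal.{u} // l < κ}

/-- The index set of an arity. -/
abbrev Arity.Idx {κ : Cardinal.{u}} (a : Arity κ) : Type u := a.1.out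

/-- The arity given by (the cardinality of) a set with fewer than `κ` elements. -/
abbrev Arity.of {κ : Cardinal.{u}} (X : Type u) (hX : #X < κ) : Arity κ := ⟨#X, hX⟩

/-- The fixed bijection between the index set of the arity `#X` and `X`. -/
noncomputable abbrev Arity.equiv {κ : Cardinal.{u}} (X : Type u) (hX : #X < κ) :
    (Arity.of X hX).Idx ≃ X := Cardinal.outMkEquiv

/-- The arity `1`. -/
abbrev Arity.one {κ : Cardinal.{u}} [hκ : Fact (ℵ₀ ≤ κ)] : Arity κ :=
  ⟨1, Cardinal.one_lt_aleph0.trans_le hκ.out⟩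

theorem mk_idx_prod_lt {κ : Cardinal.{u}} [hκ : Fact (ℵ₀ ≤ κ)] {S : Type u}
    [hS : Fact (#S < κ)] (a : Arity κ) : #(a.Idx × S) < κ := by
  have h : #(a.Idx × S) = a.1 * #S := by simp
  rw [h]
  exact Cardinal.mul_lt_of_lt hκ.out a.2 hS.out

theorem mk_prod_self_lt {κ : Cardinal.{u}} [hκ : Fact (ℵ₀ ≤ κ)] {S : Type u}
    [hS : Fact (#S < κ)] : #(S × S) < κ := by
  have h : #(S × S) = #S * #S := by simp
  rw [h]
  exact Cardinal.mul_lt_of_lt hκ.out hS.out hS.out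

/-! ### Clones -/

/-- An `S`-sorted `<κ`-ary clone. `Op a v s` is the set of operations with variables indexed by
the arity `a`, the variable `i` being of sort `v i`, and with value of sort `s`. -/
structure Clone (S : Type u) (κ : Cardinal.{u}) where
  Op : (a : Arity κ) → (a.Idx → S) → S → Type u
  proj : {a : Arity κ} → (v : a.Idx → S) → (i : a.Idx) → Op a v (v i)
  comp : {a b : Arity κ} → {v : a.Idx → S} → {w : b.Idx → S} → {s : S} →
    Op a v s → ((i : a.Idx) → Op b w (v i)) → Op b w s
  assoc : ∀ {a b c : Arity κ} {v : a.Idx → S} {w : b.Idx → S} {x : c.Idx → S} {s : S}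
    (f : Op a v s) (g : (i : a.Idx) → Op b w (v i)) (h : (j : b.Idx) → Op c x (w j)),
    comp f (fun i => comp (g i) h) = comp (comp f g) h
  proj_comp : ∀ {a b : Arity κ} {v : a.Idx → S} {w : b.Idx → S} (i : a.Idx)
    (g : (i : a.Idx) → Op b w (v i)), comp (proj v i) g = g i
  comp_proj : ∀ {a : Arity κ} {v : a.Idx → S} {s : S} (f : Op a v s), comp f (proj v) = f

/-- Single-sorted `<κ`-ary clones: the case that the set of sorts is a singleton. -/
abbrev SingleClone (κ : Cardinal.{u}) := Clone PUnit.{u + 1} κ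

namespace Clone

variable {S : Type u} {κ : Cardinal.{u}}

/-- `M_{(X, v, s)}` for a set `X` with fewer than `κ` elements. -/
abbrev OpOn (M : Clone S κ) (X : Type u) (hX : #X < κ) (v : X → S) (s : S) : Type u :=
  M.Op (Arity.of X hX) (fun i => v (Arity.equiv X hX i)) s

/-- The projection `π_{(X, v, x)}`. -/
noncomputable def projOn (M : Clone S κ) {X : Type u} (hX : #X < κ) (v : X → S) (x : X) :
    M.OpOn X hX v (v x) :=
  cast (by rw [Equiv.apply_symm_apply])
    (M.proj (fun i => v (Arity.equiv X hX i)) ((Arity.equiv X hX).symm x))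

/-- Composition with a family indexed by a set `X` with fewer than `κ` elements. -/
noncomputable def compOn (M : Clone S κ) {X : Type u} {hX : #X < κ} {v : X → S} {s : S}
    {b : Arity κ} {w : b.Idx → S} (f : M.OpOn X hX v s) (g : (x : X) → M.Op b w (v x)) :
    M.Op b w s :=
  M.comp f (fun i => g (Arity.equiv X hX i))

theorem projOn_equiv (M : Clone S κ) {X : Type u} (hX : #X < κ) (v : X → S)
    (i : (Arity.of X hX).Idx) :
    M.projOn hX v (Arity.equiv X hX i) = M.proj (fun i => v (Arity.equiv X hX i)) i := by
  unfold projOn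
  apply eq_of_heq
  refine (cast_heq _ _).trans ?_
  rw [Equiv.symm_apply_apply]

theorem compOn_projOn_left (M : Clone S κ) {X : Type u} (hX : #X < κ) {v : X → S} {b : Arity κ}
    {w : b.Idx → S} (x : X) (g : (x : X) → M.Op b w (v x)) :
    M.compOn (M.projOn hX v x) g = g x := by
  obtain ⟨i, rfl⟩ := (Arity.equiv X hX).surjective x
  rw [projOn_equiv]
  exact M.proj_comp (v := fun i => v (Arity.equiv X hX i)) i _

theorem compOn_projOn_right (M : Clone S κ) {X : Type u} (hX : #X < κ) {v : X → S} {s : S}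
    (f : M.OpOn X hX v s) : M.compOn f (M.projOn hX v) = f := by
  unfold compOn
  simp only [projOn_equiv]
  exact M.comp_proj f

theorem compOn_assoc (M : Clone S κ) {X : Type u} {hX : #X < κ} {v : X → S} {s : S}
    {b c : Arity κ} {w : b.Idx → S} {z : c.Idx → S} (f : M.OpOn X hX v s)
    (g : (x : X) → M.Op b w (v x)) (h : (j : b.Idx) → M.Op c z (w j)) :
    M.compOn f (fun x => M.comp (g x) h) = M.comp (M.compOn f g) h :=
  M.assoc f _ h

theorem compOn_compOn (M : Clone S κ) {X Y : Type u} {hX : #X < κ} {hY : #Y < κ} {v : X → S}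
    {w : Y → S} {s : S} {c : Arity κ} {z : c.Idx → S} (f : M.OpOn X hX v s)
    (g : (x : X) → M.OpOn Y hY w (v x)) (h : (y : Y) → M.Op c z (w y)) :
    M.compOn f (fun x => M.compOn (g x) h) = M.compOn (M.compOn f g) h :=
  M.assoc f _ _

/-- A clone is pure if it has a unary operation from each sort to each sort. -/
def IsPure (M : Clone S κ) [Fact (ℵ₀ ≤ κ)] : Prop :=
  ∀ s₁ s₂ : S, Nonempty (M.Op Arity.one (fun _ => s₁) s₂)

/-- Homomorphisms of clones. -/
structure Hom (C D : Clone S κ) where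
  toFun : {a : Arity κ} → {v : a.Idx → S} → {s : S} → C.Op a v s → D.Op a v s
  map_proj : ∀ {a : Arity κ} (v : a.Idx → S) (i : a.Idx), toFun (C.proj v i) = D.proj v i
  map_comp : ∀ {a b : Arity κ} {v : a.Idx → S} {w : b.Idx → S} {s : S} (f : C.Op a v s)
    (g : (i : a.Idx) → C.Op b w (v i)),
    toFun (C.comp f g) = D.comp (toFun f) (fun i => toFun (g i))

end Clone

/-! ### Algebras over a clone -/

/-- An algebra over the clone `M`. -/
structure Alg {S : Type u} {κ : Cardinal.{u}} (M : Clone S κ) where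
  carrier : S → Type u
  act : {a : Arity κ} → {v : a.Idx → S} → {s : S} → M.Op a v s →
    ((i : a.Idx) → carrier (v i)) → carrier s
  act_proj : ∀ {a : Arity κ} (v : a.Idx → S) (i : a.Idx) (x : (i : a.Idx) → carrier (v i)),
    act (M.proj v i) x = x i
  act_comp : ∀ {a b : Arity κ} {v : a.Idx → S} {w : b.Idx → S} {s : S} (f : M.Op a v s)
    (g : (i : a.Idx) → M.Op b w (v i)) (x : (j : b.Idx) → carrier (w j)),
    act (M.comp f g) x = act f (fun i => act (g i) x)

namespace Alg

variable {S : Type u} {κ : Cardinal.{u}} {M : Clone S κ}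

/-- Homomorphisms of `M`-algebras. -/
@[ext]
structure Hom (A B : Alg M) where
  toFun : (s : S) → A.carrier s → B.carrier s
  map_act : ∀ {a : Arity κ} {v : a.Idx → S} {s : S} (f : M.Op a v s)
    (x : (i : a.Idx) → A.carrier (v i)),
    toFun s (A.act f x) = B.act f (fun i => toFun (v i) (x i))

/-- The category `V(M)` of `M`-algebras. -/
instance : Category (Alg M) where
  Hom := Hom
  id A := ⟨fun _ x => x, fun _ _ => rfl⟩
  comp f g := ⟨fun s x => g.toFun s (f.toFun s x), fun h x => by rw [f.map_act, g.map_act]⟩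

/-- The action of an operation whose variables are indexed by a set `X`. -/
noncomputable def actOn (A : Alg M) {X : Type u} {hX : #X < κ} {v : X → S} {s : S}
    (f : M.OpOn X hX v s) (x : (i : X) → A.carrier (v i)) : A.carrier s :=
  A.act f (fun i => x (Arity.equiv X hX i))

theorem actOn_projOn (A : Alg M) {X : Type u} (hX : #X < κ) (v : X → S) (j : X)
    (x : (i : X) → A.carrier (v i)) : A.actOn (M.projOn hX v j) x = x j := by
  obtain ⟨i, rfl⟩ := (Arity.equiv X hX).surjective j
  rw [Clone.projOn_equiv]
  exact A.act_proj (fun i => v (Arity.equiv X hX i)) i _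

theorem act_compOn (A : Alg M) {X : Type u} {hX : #X < κ} {v : X → S} {s : S} {b : Arity κ}
    {w : b.Idx → S} (f : M.OpOn X hX v s) (g : (x : X) → M.Op b w (v x))
    (x : (j : b.Idx) → A.carrier (w j)) :
    A.act (M.compOn f g) x = A.actOn f (fun i => A.act (g i) x) :=
  A.act_comp f _ x

theorem actOn_compOn (A : Alg M) {X Y : Type u} {hX : #X < κ} {hY : #Y < κ} {v : X → S}
    {w : Y → S} {s : S} (f : M.OpOn X hX v s) (g : (x : X) → M.OpOn Y hY w (v x))
    (x : (j : Y) → A.carrier (w j)) :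
    A.actOn (hX := hY) (v := w) (M.compOn f g) x = A.actOn f (fun i => A.actOn (g i) x) :=
  A.act_comp f _ _

theorem Hom.map_actOn {A B : Alg M} (φ : Hom A B) {X : Type u} {hX : #X < κ} {v : X → S} {s : S}
    (f : M.OpOn X hX v s) (x : (i : X) → A.carrier (v i)) :
    φ.toFun s (A.actOn f x) = B.actOn f (fun i => φ.toFun (v i) (x i)) :=
  φ.map_act f _

end Alg

/-- The forgetful functor determined by a homomorphism of clones. -/
def reduct {S : Type u} {κ : Cardinal.{u}} {C D : Clone S κ} (h : Clone.Hom C D) :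
    Alg D ⥤ Alg C where
  obj A :=
    { carrier := A.carrier
      act := fun f x => A.act (h.toFun f) x
      act_proj := fun v i x => by rw [h.map_proj, A.act_proj]
      act_comp := fun f g x => by rw [h.map_comp, A.act_comp] }
  map φ := ⟨φ.toFun, fun f x => φ.map_act (h.toFun f) x⟩

/-! ### Pure sets -/

/-- `S`-sorted pure sets: families of sets that are all empty or all non-empty. -/
structure PureSet (S : Type u) where
  carrier : S → Type u
  pure : (∀ s, IsEmpty (carrier s)) ∨ (∀ s, Nonempty (carrier s))

/-- The category of `S`-sorted pure sets; morphisms are arbitrary families of mappings. -/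
instance (S : Type u) : Category (PureSet S) where
  Hom A B := (s : S) → A.carrier s → B.carrier s
  id _ := fun _ x => x
  comp f g := fun s x => g s (f s x)

/-- If `M` is pure, then the underlying family of an `M`-algebra is pure. -/
theorem Alg.carrier_pure {S : Type u} {κ : Cardinal.{u}} [Fact (ℵ₀ ≤ κ)] {M : Clone S κ}
    (hM : M.IsPure) (A : Alg M) :
    (∀ s, IsEmpty (A.carrier s)) ∨ (∀ s, Nonempty (A.carrier s)) := by
  by_cases h : ∃ s, Nonempty (A.carrier s)
  · obtain ⟨s, ⟨x⟩⟩ := h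
    exact Or.inr fun t => ⟨A.act (hM s t).some fun _ => x⟩
  · exact Or.inl fun s => not_nonempty_iff.mp fun hs => h ⟨s, hs⟩

/-- The forgetful functor from algebras over a pure clone to pure sets. -/
def forgetPure {S : Type u} {κ : Cardinal.{u}} [Fact (ℵ₀ ≤ κ)] {M : Clone S κ}
    (hM : M.IsPure) : Alg M ⥤ PureSet S where
  obj A := ⟨A.carrier, A.carrier_pure hM⟩
  map φ := φ.toFun

/-! ### Diagonal algebras -/

/-- An `S`-ary operation `d` of a single-sorted clone is a diagonal operation if it satisfies the
diagonal identity and the idempotent law. -/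
structure IsDiagonal {S : Type u} {κ : Cardinal.{u}} [Fact (ℵ₀ ≤ κ)] [hS : Fact (#S < κ)]
    (C : SingleClone κ) (d : C.OpOn S hS.out (fun _ => PUnit.unit) PUnit.unit) : Prop where
  diagonal :
    C.compOn d (fun s => C.compOn d (fun t =>
      C.projOn (mk_prod_self_lt (κ := κ) (S := S)) (fun _ => PUnit.unit) (s, t))) =
    C.compOn d (fun s => C.projOn mk_prod_self_lt (fun _ => PUnit.unit) (s, s))
  idempotent : ∀ s₀ : S,
    C.compOn d (fun _ => C.projOn hS.out (fun _ => PUnit.unit) s₀) =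
    C.projOn hS.out (fun _ => PUnit.unit) s₀

/-- Terms in variables from `X` in the language of one `S`-ary operation symbol `d`. -/
inductive DTerm (S X : Type u) : Type u
  | var : X → DTerm S X
  | d : (S → DTerm S X) → DTerm S X

namespace DTerm

variable {S : Type u}

/-- The least congruence on terms that contains all substitution instances of the diagonal
identity and of the idempotent law. -/
inductive Rel {X : Type u} : DTerm S X → DTerm S X → Prop
  | refl (t) : Rel t t
  | symm {t u} : Rel t u → Rel u t
  | trans {t u w} : Rel t u → Rel u w → Rel t w
  | congr {t u : S → DTerm S X} : (∀ s, Rel (t s) (u s)) → Rel (d t) (d u)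
  | diagonal (t : S → S → DTerm S X) : Rel (d fun s => d (t s)) (d fun s => t s s)
  | idempotent (t : DTerm S X) : Rel (d fun _ => t) t

/-- Terms up to the identities of diagonal algebras. -/
instance setoid (S X : Type u) : Setoid (DTerm S X) :=
  ⟨Rel, Rel.refl, Rel.symm, Rel.trans⟩

/-- Evaluation of a term at values `x` of the variables, `d` acting as `δ`. -/
def eval {X A : Type u} (δ : (S → A) → A) (x : X → A) : DTerm S X → A
  | var i => x i
  | d t => δ fun s => eval δ x (t s)

/-- Substitution. -/
abbrev subst {X Y : Type u} (σ : X → DTerm S Y) (t : DTerm S X) : DTerm S Y := eval d σ t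

theorem eq_rel {X : Type u} {t u : DTerm S X} (h : t = u) : Rel t u := h ▸ Rel.refl t

theorem eval_subst {X Y A : Type u} (δ : (S → A) → A) (σ : X → DTerm S Y) (x : Y → A)
    (t : DTerm S X) : eval δ x (subst σ t) = eval δ (fun i => eval δ x (σ i)) t := by
  induction t with
  | var i => rfl
  | d t ih => exact congrArg δ (funext ih)

theorem subst_var {X : Type u} (t : DTerm S X) : subst var t = t := by
  induction t with
  | var i => rfl
  | d t ih => exact congrArg d (funext ih)

theorem eval_rel {X A : Type u} {δ : (S → A) → A}
    (h₁ : ∀ y : S → S → A, (δ fun s => δ (y s)) = δ fun s => y s s)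
    (h₂ : ∀ y : A, (δ fun _ => y) = y) (x : X → A) {t u : DTerm S X} (h : Rel t u) :
    eval δ x t = eval δ x u := by
  induction h with
  | refl => rfl
  | symm _ ih => exact ih.symm
  | trans _ _ ih₁ ih₂ => exact ih₁.trans ih₂
  | congr _ ih => exact congrArg δ (funext ih)
  | diagonal t => exact h₁ fun s s' => eval δ x (t s s')
  | idempotent t => exact h₂ (eval δ x t)

theorem subst_rel {X Y : Type u} (σ : X → DTerm S Y) {t u : DTerm S X} (h : Rel t u) :
    Rel (subst σ t) (subst σ u) := by
  induction h with
  | refl => exact Rel.refl _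
  | symm _ ih => exact ih.symm
  | trans _ _ ih₁ ih₂ => exact ih₁.trans ih₂
  | congr _ ih => exact Rel.congr ih
  | diagonal t => exact Rel.diagonal fun s s' => subst σ (t s s')
  | idempotent t => exact Rel.idempotent (subst σ t)

theorem subst_rel_right {X Y : Type u} {σ τ : X → DTerm S Y} (h : ∀ i, Rel (σ i) (τ i))
    (t : DTerm S X) : Rel (subst σ t) (subst τ t) := by
  induction t with
  | var i => exact h i
  | d t ih => exact Rel.congr ih

end DTerm

/-- The clone of diagonal algebras of degree `S`: the single-sorted `<κ`-ary clone generated by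
one `S`-ary operation `d` subject to the diagonal identity and the idempotent law. -/
noncomputable def diagClone (S : Type u) (κ : Cardinal.{u}) : SingleClone κ where
  Op a _ _ := Quotient (DTerm.setoid S a.Idx)
  proj _ i := Quotient.mk _ (DTerm.var i)
  comp f g := Quotient.map (DTerm.subst fun i => (g i).out) (fun _ _ h => DTerm.subst_rel _ h) f
  assoc f g h := by
    induction f using Quotient.inductionOn with
    | h t =>
      apply Quotient.sound
      refine DTerm.Rel.trans ?_ (DTerm.eq_rel (DTerm.eval_subst _ _ _ t).symm)
      refine DTerm.subst_rel_right (fun i => ?_) t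
      refine Quotient.exact (s := DTerm.setoid S _) ((Quotient.out_eq _).trans ?_)
      exact congrArg (Quotient.map (DTerm.subst fun j => (h j).out)
        (fun _ _ h => DTerm.subst_rel _ h)) (Quotient.out_eq (g i)).symm
  proj_comp i g := Quotient.out_eq (g i)
  comp_proj f := by
    induction f using Quotient.inductionOn with
    | h t =>
      apply Quotient.sound
      change DTerm.Rel _ _
      conv_rhs => rw [← DTerm.subst_var t]
      exact DTerm.subst_rel_right (fun i => Quotient.mk_out (DTerm.var i)) t

/-- The generator `d` of the clone of diagonal algebras. -/
noncomputable def diagClone.gen (S : Type u) (κ : Cardinal.{u}) [hS : Fact (#S < κ)] :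
    (diagClone S κ).OpOn S hS.out (fun _ => PUnit.unit) PUnit.unit :=
  Quotient.mk _ (DTerm.d fun s => DTerm.var ((Arity.equiv S hS.out).symm s))

theorem diagClone.eval_comp {S : Type u} {κ : Cardinal.{u}} [hS : Fact (#S < κ)] {C : SingleClone κ}
    {d : C.OpOn S hS.out (fun _ => PUnit.unit) PUnit.unit} {a b : Arity κ} {v : a.Idx → PUnit.{u + 1}}
    {w : b.Idx → PUnit.{u + 1}} (t : DTerm S a.Idx) (g : a.Idx → C.Op b w PUnit.unit) :
    DTerm.eval (fun y => C.compOn d y) g t =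
      C.comp (DTerm.eval (A := C.Op a v PUnit.unit) (fun y => C.compOn d y)
        (fun i => C.proj v i) t) g := by
  induction t with
  | var i => exact (C.proj_comp (v := v) i g).symm
  | d t ih => exact (congrArg (C.compOn d) (funext ih)).trans (C.compOn_assoc d _ g)

section Lift

variable {S : Type u} {κ : Cardinal.{u}} [hκ : Fact (ℵ₀ ≤ κ)] [hS : Fact (#S < κ)]
  {C : SingleClone κ} {d : C.OpOn S hS.out (fun _ => PUnit.unit) PUnit.unit}

theorem IsDiagonal.diagonal_apply (hd : IsDiagonal C d) {a : Arity κ} {v : a.Idx → PUnit}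
    (y : S → S → C.Op a v PUnit.unit) :
    C.compOn d (fun s => C.compOn d (y s)) = C.compOn d (fun s => y s s) := by
  have h := congrArg (fun f => C.compOn (hX := mk_prod_self_lt (κ := κ) (S := S))
    (v := fun _ => PUnit.unit) f (fun p => y p.1 p.2)) hd.diagonal
  simpa only [← Clone.compOn_compOn, Clone.compOn_projOn_left] using h

theorem IsDiagonal.idempotent_apply [hne : Nonempty S] (hd : IsDiagonal C d) {a : Arity κ} {v : a.Idx → PUnit}
    (y : C.Op a v PUnit.unit) : C.compOn d (fun _ => y) = y := by
  have h := congrArg (fun f => C.compOn (hX := hS.out) (v := fun _ => PUnit.unit) f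
    (fun _ => y)) (hd.idempotent hne.some)
  simpa only [← Clone.compOn_compOn, Clone.compOn_projOn_left] using h

/-- The clone homomorphism from the clone of diagonal algebras that maps the generator to the
diagonal operation `d`. -/
noncomputable def diagClone.lift [Nonempty S] (hd : IsDiagonal C d) : Clone.Hom (diagClone S κ) C where
  toFun {a v s} f := Quotient.lift
    (DTerm.eval (A := C.Op a v s) (fun y => C.compOn d y) (fun i => C.proj v i))
    (fun _ _ h => DTerm.eval_rel hd.diagonal_apply hd.idempotent_apply _ h) f
  map_proj v i := rfl
  map_comp {a b v w s} f g := by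
    have hg : ∀ i, DTerm.eval (A := C.Op b w s) (fun y => C.compOn d y) (fun i => C.proj w i)
        (g i).out = Quotient.lift (DTerm.eval (A := C.Op b w s) (fun y => C.compOn d y)
          (fun i => C.proj w i)) (fun _ _ h =>
            DTerm.eval_rel hd.diagonal_apply hd.idempotent_apply _ h) (g i) := fun i => by
      conv_rhs => rw [← Quotient.out_eq (g i)]
      rfl
    induction f using Quotient.inductionOn with
    | h t =>
      refine (DTerm.eval_subst _ _ _ t).trans ?_
      simp only [hg]
      exact diagClone.eval_comp t _

theorem diagClone.lift_gen [Nonempty S] (hd : IsDiagonal C d) :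
    (diagClone.lift hd).toFun (diagClone.gen S κ) = d := by
  change C.comp d (fun i => C.proj _ ((Arity.equiv S hS.out).symm (Arity.equiv S hS.out i))) = d
  simp only [Equiv.symm_apply_apply]
  exact C.comp_proj d

end Lift

/-- The generator satisfies the defining identities. -/
theorem diagClone.isDiagonal_gen (S : Type u) (κ : Cardinal.{u}) [Fact (ℵ₀ ≤ κ)]
    [hS : Fact (#S < κ)] : IsDiagonal (diagClone S κ) (diagClone.gen S κ) := by
  have key : ∀ {b : Arity κ} (y : S → DTerm S b.Idx),
      (diagClone S κ).compOn (b := b) (w := fun _ => PUnit.unit) (diagClone.gen S κ)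
        (fun s => Quotient.mk _ (y s)) = Quotient.mk _ (DTerm.d y) := by
    intro b y
    apply Quotient.sound
    refine DTerm.Rel.congr fun s => ?_
    refine DTerm.Rel.trans (Quotient.mk_out (y (Arity.equiv S hS.out
      ((Arity.equiv S hS.out).symm s)))) ?_
    exact DTerm.eq_rel (congrArg y (Equiv.apply_symm_apply _ s))
  have hp : ∀ {X : Type u} (hX : #X < κ) (x : X),
      (diagClone S κ).projOn hX (fun _ => PUnit.unit) x =
        Quotient.mk _ (DTerm.var ((Arity.equiv X hX).symm x)) := fun _ _ => rfl
  constructor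
  · simp only [hp]
    refine Eq.trans (congrArg _ (funext fun s => key _)) ?_
    rw [key, key]
    exact Quotient.sound (DTerm.Rel.diagonal _)
  · intro s₀
    rw [hp]
    refine (key _).trans ?_
    exact Quotient.sound (DTerm.Rel.idempotent _)

/-- The category of diagonal algebras of degree `S`. -/
abbrev DiagAlg (S : Type u) (κ : Cardinal.{u}) := Alg (diagClone S κ)

/-- The diagonal algebra with underlying set `A` on which the generator acts as `δ`. -/
noncomputable def DiagAlg.ofOp {S : Type u} {κ : Cardinal.{u}} (A : Type u) (δ : (S → A) → A)
    (h₁ : ∀ y : S → S → A, (δ fun s => δ (y s)) = δ fun s => y s s)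
    (h₂ : ∀ y : A, (δ fun _ => y) = y) : DiagAlg S κ where
  carrier _ := A
  act f x := Quotient.lift (DTerm.eval δ x) (fun _ _ h => DTerm.eval_rel h₁ h₂ x h) f
  act_proj _ _ _ := rfl
  act_comp {_ _ _ _ _} f g x := by
    induction f using Quotient.inductionOn with
    | h t =>
      refine (DTerm.eval_subst _ _ _ t).trans ?_
      change _ = DTerm.eval δ _ t
      congr 1
      funext i
      conv_rhs => rw [← Quotient.out_eq (g i)]
      rfl

/-- The functor from pure sets to diagonal algebras: `(A_s)` is mapped to the product `∏ A_s`
with `d ((x_{s,t})_t)_s = (x_{s,s})_s`. -/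
noncomputable def prodFunctor (S : Type u) (κ : Cardinal.{u}) : PureSet S ⥤ DiagAlg S κ where
  obj A := DiagAlg.ofOp ((s : S) → A.carrier s) (fun x s => x s s) (fun _ => rfl) (fun _ => rfl)
  map {A B} f := ⟨fun _ x s => f s (x s), fun {a _ _} t x => by
    induction t using Quotient.inductionOn with
    | h t =>
      change (fun s => f s (DTerm.eval (fun (x : S → (s : S) → A.carrier s) s => x s s) x t s)) =
        DTerm.eval (fun (x : S → (s : S) → B.carrier s) s => x s s) (fun i s => f s (x i s)) t
      induction t with
      | var i => rfl
      | d t ih => exact funext fun s => congrFun (ih s) s⟩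

/-! ### Homogenization -/

section Homogenization

variable {S : Type u} {κ : Cardinal.{u}} [hκ : Fact (ℵ₀ ≤ κ)] [hS : Fact (#S < κ)]

/-- The homogenization `H(M)` of a clone `M`: an operation of arity `a` is a family
`(f_s)_{s ∈ S}` with `f_s ∈ M_{(a × S, p₂, s)}`. -/
noncomputable def homog (M : Clone S κ) : SingleClone κ where
  Op a _ _ := (s : S) → M.OpOn (a.Idx × S) (mk_idx_prod_lt a) Prod.snd s
  proj {a} _ i := fun s => M.projOn (mk_idx_prod_lt a) Prod.snd (i, s)
  comp f g := fun s => M.compOn (f s) (fun p => g p.1 p.2)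
  assoc f g h := funext fun s => M.compOn_compOn (f s) (fun p => g p.1 p.2) (fun p => h p.1 p.2)
  proj_comp {a _ _ _} i g := funext fun s =>
    M.compOn_projOn_left (mk_idx_prod_lt a) (v := Prod.snd) (i, s) (fun p => g p.1 p.2)
  comp_proj {a _ _} f := funext fun s => M.compOn_projOn_right (mk_idx_prod_lt a) (f s)

/-- The homogenization functor `V(M) ⥤ V(H(M))`: the underlying set of `H(A)` is `∏ A_s`, and
`(f_s)_s` acts as `((a_{i,t})_t)_i ↦ (f_s (a_{i,t})_{(i,t)})_s`. -/
noncomputable def homogFunctor (M : Clone S κ) : Alg M ⥤ Alg (homog M) where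
  obj A :=
    { carrier := fun _ => (s : S) → A.carrier s
      act := fun f x s => A.actOn (f s) (fun p => x p.1 p.2)
      act_proj := fun {a} _ i x => funext fun s =>
        A.actOn_projOn (mk_idx_prod_lt a) Prod.snd (i, s) (fun p => x p.1 p.2)
      act_comp := fun f g x => funext fun s =>
        A.actOn_compOn (f s) (fun p => g p.1 p.2) (fun p => x p.1 p.2) }
  map φ := ⟨fun _ x s => φ.toFun s (x s), fun f x => funext fun s =>
    φ.map_actOn (f s) (fun p => x p.1 p.2)⟩

/-- The diagonal term `(π_{(S × S, p₂, (s, s))})_s` of `H(M)`. -/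
noncomputable def diagTerm (M : Clone S κ) :
    (homog M).OpOn S hS.out (fun _ => PUnit.unit) PUnit.unit :=
  fun s => M.projOn (mk_idx_prod_lt _) Prod.snd ((Arity.equiv S hS.out).symm s, s)

theorem compOn_diagTerm (M : Clone S κ) {b : Arity κ} {w : b.Idx → PUnit}
    (y : S → (homog M).Op b w PUnit.unit) :
    (homog M).compOn (diagTerm M) y = fun s => y s s := by
  funext s
  refine (M.compOn_projOn_left (mk_idx_prod_lt _) (v := Prod.snd)
    ((Arity.equiv S hS.out).symm s, s)
    (fun p => y (Arity.equiv S hS.out p.1) p.2)).trans ?_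
  simp only [Equiv.apply_symm_apply]

theorem isDiagonal_diagTerm (M : Clone S κ) : IsDiagonal (homog M) (diagTerm M) where
  diagonal := by
    refine (compOn_diagTerm M _).trans (Eq.trans ?_ (compOn_diagTerm M _).symm)
    exact funext fun s => congrFun (compOn_diagTerm M _) s
  idempotent _ := compOn_diagTerm M _

/-- The forgetful functor from `H(M)`-algebras to diagonal algebras that is determined by the
clone homomorphism with `d ↦ (π_{(S × S, p₂, (s, s))})_s`. -/
noncomputable def forgetDiag [Nonempty S] (M : Clone S κ) : Alg (homog M) ⥤ DiagAlg S κ :=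
  reduct (diagClone.lift (isDiagonal_diagTerm M))

end Homogenization

end ManySorted

/-!
A set `D` with an operation `δ : (S → D) → D` that satisfies the diagonal identity and the
idempotent law is a product: call `x` and `y` `s`-equivalent if they are interchangeable as the
`s`-th argument of `δ`, and let `Factor δ s` be the quotient. Then `δ z` has the same
`s`-coordinate as `z s` (`DiagonalOp.coord_apply`), and `D → ∏ s, Factor δ s` is bijective
(`DiagonalOp.coord_bijective`). The factors are all empty or all non-empty, so no base point has to
be chosen and the empty algebra needs no separate treatment. Conversely, a mapping between products
of pure families that commutes with the diagonal operations acts coordinatewise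
(`exists_coordinatewise`), since a point can be moved in one coordinate alone. As the generator `d`
determines the action of all operations of a diagonal algebra (`DiagAlg.act_mk`), these facts make
`prodFunctor` an equivalence.

They also carry the proof for the homogenization. Let `B` be an `H(M)`-algebra. It has the diagonal
operation `diagTerm`, hence factors. The `s`-coordinate of `F x` depends only on the component `F s`
of `F` (`coord_act_congr`), because replacing `F` by `F'` outside the component `s` is an instance of
composing with the diagonal term. For the same reason, if `F s` comes from `f : M.Op a v s`, it
depends only on the `v i`-coordinates of the arguments `x i` (`coord_act_congr_right`). Purity
provides an `F` with any prescribed component `f` (`Clone.IsPure.exists_homog_op`): the other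
components are obtained from `f` by unary operations. Thus `f` acts on the factors of `B`; this is
the algebra `dehomog hM B`, whose homogenization is isomorphic to `B`. In the same way, the
coordinates of a homomorphism between homogenizations are compatible with every `f`.

The two composite functors agree on underlying sets and mappings, and `d` acts on both sides by
`(x_{s,t}) ↦ (x_{s,s})`, so all terms in `d` act in the same way.
-/

namespace ManySorted

/-! ### Sets with a diagonal operation -/

/-- A diagonal operation on a set `D`: it satisfies the diagonal identity and the idempotent
law. -/
structure DiagonalOp {S D : Type u} (δ : (S → D) → D) : Prop where
  diagonal : ∀ y : S → S → D, (δ fun s => δ (y s)) = δ fun s => y s s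
  idempotent : ∀ y : D, (δ fun _ => y) = y

namespace DiagonalOp

variable {S D : Type u} {δ : (S → D) → D}

open Classical in
/-- Two elements of `D` have the same `s`-coordinate if they are interchangeable as the `s`-th
argument of `δ`. -/
def coordSetoid (δ : (S → D) → D) (s : S) : Setoid D where
  r x y := ∀ z : S → D, δ (Function.update z s x) = δ (Function.update z s y)
  iseqv := ⟨fun _ _ => rfl, fun h z => (h z).symm, fun h h' z => (h z).trans (h' z)⟩

/-- The `s`-th factor of the set `D` with respect to `δ`. -/
abbrev Factor (δ : (S → D) → D) (s : S) : Type u := Quotient (coordSetoid δ s)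

/-- The coordinates of an element of `D`. -/
def coord (δ : (S → D) → D) (x : D) (s : S) : Factor δ s := Quotient.mk _ x

theorem coord_surjective (δ : (S → D) → D) (s : S) (q : Factor δ s) : ∃ x, coord δ x s = q :=
  Quotient.exists_rep q

theorem coord_apply (h : DiagonalOp δ) (z : S → D) (s : S) :
    coord δ (δ z) s = coord δ (z s) s := by
  classical
  refine Quotient.sound fun w => ?_
  have h₁ := h.diagonal (Function.update (fun t _ => w t) s z)
  -- The rows of this matrix other than the row `s` are constant.
  have h₂ : (fun t => δ (Function.update (fun t _ => w t) s z t)) = Function.update w s (δ z) := by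
    funext t
    by_cases ht : t = s
    · subst ht; simp
    · simp [ht, h.idempotent]
  have h₃ : (fun t => Function.update (fun t (_ : S) => w t) s z t t) =
      Function.update w s (z s) := by
    funext t
    by_cases ht : t = s
    · subst ht; simp
    · simp [ht]
  rwa [h₂, h₃] at h₁

theorem coord_injective (h : DiagonalOp δ) : Function.Injective (coord δ) := by
  classical
  intro x y hxy
  have h₁ : ∀ s, δ (Function.update (fun _ => x) s y) = x := fun s => by
    rw [← Quotient.exact (congrFun hxy s) fun _ => x, Function.update_eq_self s fun _ => x,
      h.idempotent]
  have h₂ := h.diagonal fun s => Function.update (fun _ => x) s y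
  simpa [h₁, h.idempotent] using h₂

theorem coord_bijective (h : DiagonalOp δ) : Function.Bijective (coord δ) :=
  ⟨h.coord_injective, fun q => ⟨δ fun s => (q s).out, funext fun s =>
    (h.coord_apply _ s).trans (Quotient.out_eq _)⟩⟩

theorem factor_pure (δ : (S → D) → D) :
    (∀ s, IsEmpty (Factor δ s)) ∨ (∀ s, Nonempty (Factor δ s)) := by
  rcases isEmpty_or_nonempty D with h | ⟨⟨x⟩⟩
  · exact Or.inl fun s => ⟨fun q => (coord_surjective δ s q).elim fun x _ => h.false x⟩
  · exact Or.inr fun s => ⟨coord δ x s⟩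

/-- If `x` and `x'` have the same `s`-coordinate, then `x` is a value of `δ` with `s`-th argument
`x'`; so composing with `δ` can exchange `x` for `x'`. -/
theorem exists_apply_eq (h : DiagonalOp δ) {s : S} {x x' : D}
    (hx : coord δ x s = coord δ x' s) : ∃ z : S → D, δ z = x ∧ z s = x' := by
  classical
  refine ⟨Function.update (fun _ => x) s x', ?_, by simp⟩
  rw [← Quotient.exact hx fun _ => x, Function.update_eq_self s fun _ => x, h.idempotent]

end DiagonalOp

/-! ### Products of pure families -/

section Pure

variable {S : Type u} {A B : S → Type u}

/-- In a pure family, every element of a member extends to an element of the product. -/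
theorem exists_section (hA : (∀ s, IsEmpty (A s)) ∨ (∀ s, Nonempty (A s))) (s : S) (a : A s) :
    ∃ x : (t : S) → A t, x s = a := by
  classical
  rcases hA with h | h
  · exact (h s).elim a
  · exact ⟨Function.update (fun t => (h t).some) s a, by simp⟩

/-- A mapping between products of pure families that commutes with the diagonal operations acts
coordinatewise. -/
theorem exists_coordinatewise (hA : (∀ s, IsEmpty (A s)) ∨ (∀ s, Nonempty (A s)))
    (h : ((s : S) → A s) → (s : S) → B s)
    (hd : ∀ z : S → (s : S) → A s, (h fun s => z s s) = fun s => h (z s) s) :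
    ∃ k : (s : S) → A s → B s, ∀ x s, h x s = k s (x s) := by
  classical
  choose x hx using exists_section hA
  refine ⟨fun s a => h (x s a) s, fun y s => ?_⟩
  -- The diagonal of this family is `y`, while its member at `s` depends on `y s` only.
  have h₁ := congrFun (hd (Function.update (fun _ => y) s (x s (y s)))) s
  have h₂ : (fun t => Function.update (fun _ => y) s (x s (y s)) t t) = y := by
    funext t
    by_cases ht : t = s
    · subst ht; simp [hx]
    · simp [ht]
  rw [h₂] at h₁
  simpa using h₁

end Pure

/-! ### Homomorphisms of algebras -/

section Alg

variable {S : Type u} {κ : Cardinal.{u}} {M : Clone S κ}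

/-- A bijective homomorphism of algebras is an isomorphism. -/
theorem Alg.isIso_of_bijective {A B : Alg M} (φ : A ⟶ B)
    (h : ∀ s, Function.Bijective (Alg.Hom.toFun φ s)) : IsIso φ := by
  let e := fun s => Equiv.ofBijective _ (h s)
  refine ⟨⟨⟨fun s => (e s).symm, fun {a v s} f x => ?_⟩, ?_, ?_⟩⟩
  · refine (e s).injective ?_
    refine ((e s).apply_symm_apply _).trans ?_
    refine Eq.trans ?_ (Alg.Hom.map_act φ f _).symm
    exact congrArg _ (funext fun i => ((e (v i)).apply_symm_apply (x i)).symm)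
  · exact Alg.Hom.ext (funext fun s => funext fun x => (e s).symm_apply_apply x)
  · exact Alg.Hom.ext (funext fun s => funext fun x => (e s).apply_symm_apply x)

theorem Alg.mk_congr {c : S → Type u}
    {act act' : {a : Arity κ} → {v : a.Idx → S} → {s : S} → M.Op a v s →
      ((i : a.Idx) → c (v i)) → c s}
    (h : @act = @act') (h₁ h₂ h₁' h₂') :
    (⟨c, act, h₁, h₂⟩ : Alg M) = ⟨c, act', h₁', h₂'⟩ := by
  subst h
  rfl

/-- Homomorphisms between equal algebras are equal if their underlying mappings are. -/
theorem Alg.hom_heq {A A' B B' : Alg M} (hA : A = A') (hB : B = B') {φ : A ⟶ B} {ψ : A' ⟶ B'}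
    (h : HEq (Alg.Hom.toFun φ) (Alg.Hom.toFun ψ)) : HEq φ ψ := by
  subst hA hB
  exact heq_of_eq (Alg.Hom.ext (eq_of_heq h))

end Alg

/-! ### Diagonal algebras -/

section Diagonal

variable {S : Type u} {κ : Cardinal.{u}} [hS : Fact (#S < κ)]

/-- A diagonal operation of a clone acts as a diagonal operation on every algebra. -/
theorem IsDiagonal.actOn [Fact (ℵ₀ ≤ κ)] [hne : Nonempty S] {C : SingleClone κ}
    {d : C.OpOn S hS.out (fun _ => PUnit.unit) PUnit.unit} (hd : IsDiagonal C d) (A : Alg C) :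
    DiagonalOp fun x : S → A.carrier PUnit.unit =>
      A.actOn (hX := hS.out) (v := fun _ => PUnit.unit) d x where
  diagonal y := by
    have h := congrArg (fun f => A.actOn (hX := mk_prod_self_lt (κ := κ) (S := S))
      (v := fun _ => PUnit.unit) f (fun p => y p.1 p.2)) hd.diagonal
    simpa only [Alg.actOn_compOn, Alg.actOn_projOn] using h
  idempotent y := by
    have h := congrArg (fun f => A.actOn (hX := hS.out) (v := fun _ => PUnit.unit) f
      (fun _ => y)) (hd.idempotent hne.some)
    simpa only [Alg.actOn_compOn, Alg.actOn_projOn] using h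

namespace DiagAlg

/-- The diagonal operation of a diagonal algebra. -/
noncomputable def op (A : DiagAlg S κ) (x : S → A.carrier PUnit.unit) : A.carrier PUnit.unit :=
  A.actOn (hX := hS.out) (v := fun _ => PUnit.unit) (diagClone.gen S κ) x

theorem diagonalOp_op [Fact (ℵ₀ ≤ κ)] [Nonempty S] (A : DiagAlg S κ) : DiagonalOp A.op :=
  (diagClone.isDiagonal_gen S κ).actOn A

theorem compOn_gen {b : Arity κ} (y : S → DTerm S b.Idx) :
    (diagClone S κ).compOn (b := b) (w := fun _ => PUnit.unit) (diagClone.gen S κ)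
      (fun s => Quotient.mk _ (y s)) = Quotient.mk _ (DTerm.d y) := by
  apply Quotient.sound
  refine DTerm.Rel.congr fun s => ?_
  refine DTerm.Rel.trans (Quotient.mk_out (y (Arity.equiv S hS.out
    ((Arity.equiv S hS.out).symm s)))) ?_
  exact DTerm.eq_rel (congrArg y (Equiv.apply_symm_apply _ s))

/-- The generator `d` determines the action of all operations of a diagonal algebra. -/
theorem act_mk (A : DiagAlg S κ) {a : Arity κ} (t : DTerm S a.Idx)
    (x : a.Idx → A.carrier PUnit.unit) :
    A.act (a := a) (v := fun _ => PUnit.unit) (s := PUnit.unit) (Quotient.mk _ t) x =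
      DTerm.eval A.op x t := by
  induction t with
  | var i => exact A.act_proj (fun _ => PUnit.unit) i x
  | d t ih =>
    rw [← compOn_gen]
    refine (A.act_compOn _ _ x).trans ?_
    exact congrArg A.op (funext ih)

/-- A mapping between diagonal algebras that preserves `d` is a homomorphism. -/
noncomputable def homOfOp (A B : DiagAlg S κ)
    (h : A.carrier PUnit.unit → B.carrier PUnit.unit)
    (hd : ∀ x, h (A.op x) = B.op fun s => h (x s)) : A ⟶ B where
  toFun _ := h
  map_act {a v _} f x := by
    induction f using Quotient.inductionOn with
    | h t =>
      refine (congrArg h (A.act_mk t x)).trans (Eq.trans ?_ (B.act_mk t _).symm)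
      induction t with
      | var i => rfl
      | d t ih => exact (hd _).trans (congrArg B.op (funext ih))

theorem op_prodFunctor (A : PureSet S) (z : S → (s : S) → A.carrier s) :
    op ((prodFunctor S κ).obj A) z = fun s => z s s := by
  change (fun s => z (Arity.equiv S hS.out ((Arity.equiv S hS.out).symm s)) s) = _
  simp only [Equiv.apply_symm_apply]

end DiagAlg

theorem prodFunctor_isEquivalence [Fact (ℵ₀ ≤ κ)] [Nonempty S] :
    (prodFunctor S κ).IsEquivalence where
  faithful := ⟨fun {A B f g} h => by
    funext s a
    obtain ⟨x, rfl⟩ := exists_section A.pure s a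
    exact congrFun (congrFun (congrFun (congrArg Alg.Hom.toFun h) PUnit.unit) x) s⟩
  full := ⟨fun {A B} φ => by
    obtain ⟨k, hk⟩ := exists_coordinatewise (B := B.carrier) A.pure (Alg.Hom.toFun φ PUnit.unit)
      (fun z => by
        rw [← DiagAlg.op_prodFunctor (κ := κ)]
        refine (Alg.Hom.map_actOn φ (diagClone.gen S κ) z).trans ?_
        exact DiagAlg.op_prodFunctor (κ := κ) B _)
    exact ⟨k, Alg.Hom.ext (funext fun _ => funext fun x => funext fun s => (hk x s).symm)⟩⟩
  essSurj := ⟨fun D => by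
    have hδ := D.diagonalOp_op
    let A : PureSet S := ⟨_, DiagonalOp.factor_pure D.op⟩
    let φ : D ⟶ (prodFunctor S κ).obj A := DiagAlg.homOfOp D _ (DiagonalOp.coord D.op) fun x => by
      rw [DiagAlg.op_prodFunctor]
      exact funext (hδ.coord_apply x)
    have : IsIso φ := Alg.isIso_of_bijective φ fun _ => hδ.coord_bijective
    exact ⟨A, ⟨(asIso φ).symm⟩⟩⟩

end Diagonal

/-! ### Algebras over the homogenization -/

section Homogenization

variable {S : Type u} {κ : Cardinal.{u}} [hκ : Fact (ℵ₀ ≤ κ)] [hS : Fact (#S < κ)]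
  {M : Clone S κ}

/-- The operation `f` of `M`, with the variable `i` of sort `v i` regarded as the variable
`(i, v i)` out of the variables of an operation of `H(M)`. -/
noncomputable def Clone.inflate (M : Clone S κ) {a : Arity κ} {v : a.Idx → S} {s : S}
    (f : M.Op a v s) : M.OpOn (a.Idx × S) (mk_idx_prod_lt a) Prod.snd s :=
  M.comp f fun i => M.projOn (mk_idx_prod_lt a) Prod.snd (i, v i)

theorem Clone.compOn_inflate (M : Clone S κ) {a b : Arity κ} {v : a.Idx → S} {w : b.Idx → S}
    {s : S} (f : M.Op a v s) (g : (p : a.Idx × S) → M.Op b w p.2) :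
    M.compOn (M.inflate f) g = M.comp f fun i => g (i, v i) := by
  refine (M.assoc f _ _).symm.trans (congrArg (M.comp f) (funext fun i => ?_))
  exact M.compOn_projOn_left (mk_idx_prod_lt a) (v := Prod.snd) (i, v i) g

theorem Alg.actOn_inflate (A : Alg M) {a : Arity κ} {v : a.Idx → S}
    {s : S} (f : M.Op a v s) (x : (p : a.Idx × S) → A.carrier p.2) :
    A.actOn (M.inflate f) x = A.act f fun i => x (i, v i) := by
  refine (A.act_comp f _ _).trans (congrArg (A.act f) (funext fun i => ?_))
  exact A.actOn_projOn (mk_idx_prod_lt a) Prod.snd (i, v i) x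

/-- In a pure clone, every operation is a component of an operation of the homogenization. -/
theorem Clone.IsPure.exists_homog_op (hM : M.IsPure) {a : Arity κ} {s : S}
    (f : M.OpOn (a.Idx × S) (mk_idx_prod_lt a) Prod.snd s) (w : a.Idx → PUnit) :
    ∃ F : (homog M).Op a w PUnit.unit, F s = f := by
  classical
  exact ⟨Function.update (fun t => M.comp (hM s t).some fun _ => f) s f, by simp⟩

/-- The underlying set of an algebra over the homogenization has a diagonal operation. -/
noncomputable def homogOp (B : Alg (homog M)) (x : S → B.carrier PUnit.unit) :
    B.carrier PUnit.unit :=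
  B.actOn (hX := hS.out) (v := fun _ => PUnit.unit) (diagTerm M) x

theorem diagonalOp_homogOp [Nonempty S] (B : Alg (homog M)) : DiagonalOp (homogOp B) :=
  (isDiagonal_diagTerm M).actOn B

theorem homogOp_homogFunctor (A : Alg M) (z : S → (s : S) → A.carrier s) :
    homogOp ((homogFunctor M).obj A) z = fun s => z s s := by
  funext s
  refine (A.actOn_projOn (mk_idx_prod_lt _) Prod.snd ((Arity.equiv S hS.out).symm s, s)
    (fun p => z (Arity.equiv S hS.out p.1) p.2)).trans ?_
  simp only [Equiv.apply_symm_apply]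

/-- An operation of `H(M)` whose component of sort `s` is a given operation `f` of `M`. -/
noncomputable def extendOp (hM : M.IsPure) {a : Arity κ} {v : a.Idx → S} {s : S}
    (f : M.Op a v s) : (homog M).Op a (fun _ => PUnit.unit) PUnit.unit :=
  (hM.exists_homog_op (M.inflate f) fun _ => PUnit.unit).choose

theorem extendOp_apply (hM : M.IsPure) {a : Arity κ} {v : a.Idx → S} {s : S}
    (f : M.Op a v s) : extendOp hM f s = M.inflate f :=
  (hM.exists_homog_op (M.inflate f) fun _ => PUnit.unit).choose_spec

theorem homog_comp_apply {a b : Arity κ} {v : a.Idx → PUnit} {w : b.Idx → PUnit} {t : PUnit}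
    (F : (homog M).Op a v t) (g : (i : a.Idx) → (homog M).Op b w (v i)) (s : S) :
    (homog M).comp F g s = M.compOn (F s) fun p => g p.1 p.2 :=
  rfl

section Coordinates

variable [Nonempty S] (B : Alg (homog M))

/-- The `s`-coordinate of a value of `F` depends on the component `F s` only. -/
theorem coord_act_congr {a : Arity κ} {s : S} {w : a.Idx → PUnit}
    {F F' : (homog M).Op a w PUnit.unit} (h : F s = F' s)
    (x : a.Idx → B.carrier PUnit.unit) :
    DiagonalOp.coord (homogOp B) (B.act F x) s = DiagonalOp.coord (homogOp B) (B.act F' x) s := by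
  classical
  -- `F` is recovered from the family that is `F'` in the place `s` and `F` elsewhere.
  have h₁ : (homog M).compOn (diagTerm M) (Function.update (fun _ => F) s F') = F := by
    rw [compOn_diagTerm]
    funext t
    by_cases ht : t = s
    · subst ht; simp [h]
    · simp [ht]
  have h₂ : B.act F x =
      homogOp B fun t => B.act (Function.update (fun _ => F) s F' t) x := by
    conv_lhs => rw [← h₁]
    exact B.act_compOn _ _ x
  rw [h₂, (diagonalOp_homogOp B).coord_apply]
  simp

/-- If the component `F s` comes from an operation with the variable `i` of sort `v i`, then the
`s`-coordinate of a value of `F` depends only on the `v i`-coordinate of the `i`-th argument. -/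
theorem coord_act_congr_right {a : Arity κ} {v : a.Idx → S} {s : S} {w : a.Idx → PUnit}
    {F : (homog M).Op a w PUnit.unit} {f : M.Op a v s} (hF : F s = M.inflate f)
    {x x' : a.Idx → B.carrier PUnit.unit}
    (h : ∀ i, DiagonalOp.coord (homogOp B) (x i) (v i) =
      DiagonalOp.coord (homogOp B) (x' i) (v i)) :
    DiagonalOp.coord (homogOp B) (B.act F x) s = DiagonalOp.coord (homogOp B) (B.act F x') s := by
  choose z hz hz' using fun i => (diagonalOp_homogOp B).exists_apply_eq (h i)
  -- Both sides are values at `z` of operations in the variables `a × S`.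
  let π : a.Idx × S → (homog M).OpOn (a.Idx × S) (mk_idx_prod_lt a) (fun _ => PUnit.unit)
      PUnit.unit := (homog M).projOn (mk_idx_prod_lt a) fun _ => PUnit.unit
  let z' : (Arity.of (κ := κ) (a.Idx × S) (mk_idx_prod_lt a)).Idx → B.carrier PUnit.unit :=
    fun j => z (Arity.equiv _ (mk_idx_prod_lt a) j).1 (Arity.equiv _ (mk_idx_prod_lt a) j).2
  have hπ : ∀ p, B.act (π p) z' = z p.1 p.2 := fun p =>
    B.actOn_projOn (mk_idx_prod_lt a) (fun _ => PUnit.unit) p fun p => z p.1 p.2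
  have h₁ : B.act F x = B.act ((homog M).comp F fun i =>
      (homog M).compOn (diagTerm M) fun t => π (i, t)) z' := by
    rw [B.act_comp]
    refine congrArg (B.act F) (funext fun i => ?_)
    rw [B.act_compOn, ← hz i]
    exact congrArg (homogOp B) (funext fun t => (hπ (i, t)).symm)
  have h₂ : B.act F x' = B.act ((homog M).comp F fun i => π (i, v i)) z' := by
    rw [B.act_comp]
    refine congrArg (B.act F) (funext fun i => ?_)
    rw [hπ, ← hz' i]
  rw [h₁, h₂]
  refine coord_act_congr B ?_ z'
  rw [homog_comp_apply, homog_comp_apply, hF, M.compOn_inflate, M.compOn_inflate]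
  refine congrArg (M.comp f) (funext fun i => ?_)
  change (homog M).compOn (diagTerm M) (fun t => π (i, t)) (v i) = _
  rw [compOn_diagTerm]

/-- The `M`-algebra on the factors of an algebra `B` over the homogenization: `f` acts on
representatives through an operation of `H(M)` that has `f` as a component. -/
noncomputable def dehomog (hM : M.IsPure) (B : Alg (homog M)) : Alg M where
  carrier := DiagonalOp.Factor (homogOp B)
  act {a v s} f y := DiagonalOp.coord (homogOp B)
    (B.act (extendOp hM f) fun i => (y i).out) s
  act_proj {a} v i y := by
    refine (coord_act_congr B (F' := (homog M).proj (fun _ => PUnit.unit) i) ?_ _).trans ?_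
    · rw [extendOp_apply]
      exact M.proj_comp i _
    · rw [B.act_proj]
      exact Quotient.out_eq (y i)
  act_comp {a b v w s} f g y := by
    refine Eq.trans ?_ (coord_act_congr_right B (extendOp_apply hM f) fun i =>
      (Quotient.out_eq _).symm)
    rw [← B.act_comp]
    refine coord_act_congr B ?_ _
    rw [homog_comp_apply, extendOp_apply, extendOp_apply, M.compOn_inflate]
    refine (M.assoc f g _).symm.trans (congrArg (M.comp f) (funext fun i => ?_))
    exact (extendOp_apply hM (g i)).symm

theorem dehomog_act (hM : M.IsPure) (B : Alg (homog M)) {a : Arity κ} {v : a.Idx → S} {s : S}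
    (f : M.Op a v s) (x : a.Idx → B.carrier PUnit.unit) :
    (dehomog hM B).act f (fun i => DiagonalOp.coord (homogOp B) (x i) (v i)) =
      DiagonalOp.coord (homogOp B) (B.act (extendOp hM f) x) s :=
  coord_act_congr_right B (extendOp_apply hM f) fun _ => Quotient.out_eq _

/-- The decomposition of an algebra over the homogenization into its factors. -/
noncomputable def toHomogDehomog (hM : M.IsPure) (B : Alg (homog M)) :
    B ⟶ (homogFunctor M).obj (dehomog hM B) where
  toFun _ := DiagonalOp.coord (homogOp B)
  map_act {a w _} F x := by
    funext s
    refine Eq.trans ?_ (dehomog_act hM B (F s)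
      fun j => x (Arity.equiv (a.Idx × S) (mk_idx_prod_lt a) j).1).symm
    -- Identify the variables `(i, t)` with `i`.
    have h : (B.act (extendOp hM (F s))
        fun j => x (Arity.equiv (a.Idx × S) (mk_idx_prod_lt a) j).1) =
        B.act ((homog M).comp (extendOp hM (F s)) fun j =>
          (homog M).proj w (Arity.equiv (a.Idx × S) (mk_idx_prod_lt a) j).1) x := by
      rw [B.act_comp]
      exact congrArg (B.act _) (funext fun j => (B.act_proj w _ x).symm)
    rw [h]
    refine coord_act_congr B ?_ x
    rw [homog_comp_apply, extendOp_apply, M.compOn_inflate]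
    exact (M.compOn_projOn_right (mk_idx_prod_lt a) (F s)).symm

end Coordinates

/-! ### The homogenization functor -/

theorem homogFunctor_isEquivalence [Nonempty S] (hM : M.IsPure) :
    (homogFunctor M).IsEquivalence where
  faithful := ⟨fun {A B f g} h => by
    refine Alg.Hom.ext (funext fun s => funext fun a => ?_)
    obtain ⟨x, rfl⟩ := exists_section (A.carrier_pure hM) s a
    exact congrFun (congrFun (congrFun (congrArg Alg.Hom.toFun h) PUnit.unit) x) s⟩
  full := ⟨fun {A B} φ => by
    obtain ⟨k, hk⟩ := exists_coordinatewise (B := B.carrier) (A.carrier_pure hM)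
      (Alg.Hom.toFun φ PUnit.unit) (fun z => by
        rw [← homogOp_homogFunctor]
        refine (Alg.Hom.map_actOn φ (diagTerm M) z).trans ?_
        exact homogOp_homogFunctor B _)
    refine ⟨⟨k, fun {a v s} f y => ?_⟩, Alg.Hom.ext (funext fun _ => funext fun x =>
      funext fun s => (hk x s).symm)⟩
    -- Apply the homomorphism property of `φ` to an operation of `H(M)` with component `f`.
    choose x hx using fun i => exists_section (A.carrier_pure hM) (v i) (y i)
    have h := congrFun (Alg.Hom.map_act φ (extendOp hM f) x) s
    have hA : A.actOn (extendOp hM f s) (fun p => x p.1 p.2) = A.act f y := by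
      rw [extendOp_apply, A.actOn_inflate]
      exact congrArg (A.act f) (funext hx)
    have hB : B.actOn (extendOp hM f s)
        (fun p => Alg.Hom.toFun φ PUnit.unit (x p.1) p.2) = B.act f fun i => k (v i) (y i) := by
      rw [extendOp_apply, B.actOn_inflate]
      exact congrArg (B.act f) (funext fun i => (hk _ _).trans (congrArg _ (hx i)))
    exact (congrArg (k s) hA).symm.trans ((hk _ s).symm.trans (h.trans hB))⟩
  essSurj := ⟨fun B => by
    let φ := toHomogDehomog hM B
    have : IsIso φ := Alg.isIso_of_bijective φ fun _ => (diagonalOp_homogOp B).coord_bijective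
    exact ⟨_, ⟨(asIso φ).symm⟩⟩⟩

theorem homogFunctor_comp_forgetDiag [Nonempty S] (hM : M.IsPure) :
    homogFunctor M ⋙ forgetDiag M = forgetPure hM ⋙ prodFunctor S κ := by
  have hobj : ∀ A : Alg M, (homogFunctor M ⋙ forgetDiag M).obj A =
      (forgetPure hM ⋙ prodFunctor S κ).obj A := by
    intro A
    refine Alg.mk_congr ?_ _ _ _ _
    funext a v s f x
    -- Terms in `d` act in the same way on both sides, because `d` does.
    induction f using Quotient.inductionOn with
    | h t =>
      refine (((forgetDiag M).obj ((homogFunctor M).obj A)).act_mk t x).trans ?_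
      have hop : DiagAlg.op ((forgetDiag M).obj ((homogFunctor M).obj A)) =
          fun (z : S → (s : S) → A.carrier s) s => z s s := by
        funext z
        refine Eq.trans ?_ (homogOp_homogFunctor A z)
        exact congrArg (fun d => Alg.actOn ((homogFunctor M).obj A) (hX := hS.out)
          (v := fun _ => PUnit.unit) d z) (diagClone.lift_gen (isDiagonal_diagTerm M))
      rw [hop]
      rfl
  exact Functor.hext hobj fun A B φ => Alg.hom_heq (hobj A) (hobj B) HEq.rfl

end Homogenization

end ManySorted

theorem mainTheorem3 (κ : Cardinal.{u}) [Fact (Cardinal.aleph0 ≤ κ)] (S : Type u) [Nonempty S]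
    [Fact (Cardinal.mk S < κ)] (M : ManySorted.Clone S κ) (hM : M.IsPure) :
    (ManySorted.prodFunctor S κ).IsEquivalence ∧
    (ManySorted.homogFunctor M).IsEquivalence ∧
    ManySorted.homogFunctor M ⋙ ManySorted.forgetDiag M =
      ManySorted.forgetPure hM ⋙ ManySorted.prodFunctor S κ :=
  ⟨ManySorted.prodFunctor_isEquivalence, ManySorted.homogFunctor_isEquivalence hM,
    ManySorted.homogFunctor_comp_forgetDiag hM⟩
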